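/- For a finite graph $G$ put $d(v,v')=0$ if $v=v'$, $d(v,v')=1$ if $v,v'$ are adjacent, and $d(v,v')=\infty$ otherwise. For $n\ge 1$ and real $d$ let $G(n,d)$ be the graph on $V(G)^n$ in which two distinct words $x,x'$ are adjacent if $\sum_{j=1}^n d(x_j,x'_j)\le d$. Let $\alpha$ denote the independence number, and set $$R^*(G,\delta)=\limsup_{n\to\infty}\frac1n\log\alpha(G(n,\delta n)).$$ Let $$\theta_L(G)=\min\Big\{\max_{v}D_{v,v}: D\in\mathbb{R}^{V(G)\times V(G)},\ D\succeq J,\ D_{v,v'}=0 \text{ whenever } v\ne v' \text{ are non-adjacent}\Big\}$$ be the Lovász theta function, where $J$ is the all-ones matrix and $D\succeq J$ means that $D-J$ is symmetric positive semidefinite. With $H_q(x)=x\log(q-1)-x\log x-(1-x)\log(1-x)$ (and $0\log 0=0$), let $$R_{LP1}(q,\delta)=H_q\!\left(\frac{(q-1)-(q-2)\delta-2\sqrt{(q-1)\delta(1-\delta)}}{q}\right)\ \text{ if } 0\le\delta<1-\tfrac1q,\qquad R_{LP1}(q,\delta)=0\ \text{ if } \delta\ge 1-\tfrac1q.$$ All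 logarithms are to the same base. Let $q\ge 3$ be odd and let $C_q$ be the $q$-cycle. Then for every $\delta\ge 0$, $$R^*(C_q,\delta)\le\log\theta_L(C_q)+R_{LP1}(q,\delta).$$ In particular, $R^*(C_q,\delta)\le\log\theta_L(C_q)$ for every $\delta\ge 1-\tfrac1q$. -/

import Mathlib

noncomputable section

namespace CycleCode

/-- The semimetric of a graph on its vertices: `0` on the diagonal, `1` on edges,
`∞` between distinct non-adjacent vertices. -/
def vertexDist {V : Type*} (G : SimpleGraph V) (v w : V) : EReal :=
  open Classical in if v = w then 0 else if G.Adj v w then 1 else ⊤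

theorem vertexDist_comm {V : Type*} (G : SimpleGraph V) (v w : V) :
    vertexDist G v w = vertexDist G w v := by
  by_cases h : v = w
  · rw [h]
  · by_cases hA : G.Adj v w
    · simp [vertexDist, h, Ne.symm h, hA, hA.symm]
    · have hA' : ¬ G.Adj w v := fun k => hA k.symm
      simp [vertexDist, h, Ne.symm h, hA, hA']

/-- The additive extension of `vertexDist` to words of length `n`. -/
def wordDist {V : Type*} (G : SimpleGraph V) {n : ℕ} (x y : Fin n → V) : EReal :=
  ∑ j, vertexDist G (x j) (y j)

/-- The graph `G(n,d)`: words of length `n`, distinct words `x`, `y` being adjacent when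
their distance is at most `d`. -/
def wordGraph {V : Type*} (G : SimpleGraph V) (n : ℕ) (d : ℝ) : SimpleGraph (Fin n → V) where
  Adj x y := x ≠ y ∧ wordDist G x y ≤ (d : EReal)
  symm := ⟨fun x y h => ⟨h.1.symm, by
    have e : wordDist G y x = wordDist G x y :=
      Finset.sum_congr rfl fun j _ => vertexDist_comm G (y j) (x j)
    exact e ▸ h.2⟩⟩
  loopless := ⟨fun _ h => h.1 rfl⟩

/-- `R^*(G,δ) = limsup (1/n) log α(G(n, δn))`, with the natural logarithm. The sequence lies
between `0` and `log |V|`, so this is an honest limit superior. -/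
def rate {V : Type*} [Fintype V] [Nonempty V] (G : SimpleGraph V) (δ : ℝ) : ℝ :=
  Filter.limsup
    (fun n : ℕ => (1 / (n : ℝ)) * Real.log ((wordGraph G n (δ * n)).indepNum : ℝ)) Filter.atTop

/-- `D` is feasible for the Lovász function of `G`: `D ⪰ J` with `J` the all-ones matrix, and
`D` vanishes on the edges of the complement of `G`. -/
def IsLovaszFeasible {V : Type*} [Fintype V] (G : SimpleGraph V) (D : Matrix V V ℝ) : Prop :=
  (D - Matrix.of fun _ _ => (1 : ℝ)).PosSemidef ∧ ∀ v w, Gᶜ.Adj v w → D v w = 0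

/-- The Lovász theta function: the least value of `max_v D v v` over feasible `D`. -/
def lovaszTheta {V : Type*} [Fintype V] [Nonempty V] (G : SimpleGraph V) : ℝ :=
  sInf {t : ℝ | ∃ D : Matrix V V ℝ, IsLovaszFeasible G D ∧
    t = Finset.univ.sup' Finset.univ_nonempty fun v => D v v}

/-- The first linear programming (MRRW) rate bound for the `q`-ary Hamming space. Here
`Real.qaryEntropy q x = x log (q-1) - x log x - (1-x) log (1-x)`. -/
def rateLP1 (q : ℕ) (δ : ℝ) : ℝ :=
  if δ < 1 - 1 / (q : ℝ) then
    Real.qaryEntropy q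
      ((((q : ℝ) - 1) - ((q : ℝ) - 2) * δ - 2 * √(((q : ℝ) - 1) * δ * (1 - δ))) / (q : ℝ))
  else 0

end CycleCode

end

/-!
Identify the vertices of `C_q` with `ZMod q`. A maximum independent set of `C_q(n, δ n)` becomes a
code `C` in `(ZMod q)^n` in which two distinct words either differ in some letter by an element
outside `{0, 1, -1}` or have Hamming distance larger than `δ n`. Two functions on `(ZMod q)^n` are
multiplied and the product is used in Delsarte's linear programming bound `HasSpectrum.card_le`.

* `g`, the `n`-fold tensor power of `cycleKernel q`. The kernel is the optimal matrix for
  `θ_L(C_q)`, rescaled to have diagonal `1`. It is nonnegative, vanishes outside `{0, 1, -1}`, has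
  nonnegative Fourier coefficients because `q` is odd, and its mean is `1 / θ` with
  `θ = q / (1 + 2 * cycleCoeff q)`.
* `h`, a feasible function for the linear programming bound in the Hamming space: its Fourier
  coefficients are nonnegative and `h ≤ 0` at all words of weight larger than `δ n`.

Since `g ≥ 0`, the product is nonpositive on all nonzero differences of `C`. Its spectrum is the
convolution of two nonnegative spectra, so its mean is at least the product of the means. Hence
`|C| ≤ θ ^ n * h 0 / mean h` (`card_le_of_hasSpectrum`). That `θ ≤ θ_L(C_q)` is
`le_lovaszTheta_cycleGraph`.

For `h` one takes `h z = (n (q - 1) - q |z| - t) * |F z| ^ 2`, where the first two terms are the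
Hamming eigenvalue and `F` has a nonnegative spectrum `f`. Multiplication by the eigenvalue is the
adjacency operator `A` of the Hamming graph on the side of the spectrum, so `h` is feasible for
`t = n ((q - 1) - q δ)` as soon as `A f ≥ lam f` with `lam > t`, and by Cauchy-Schwarz
`h 0 / mean h ≤ (n (q - 1) - t) / (lam - t) * |supp f|` (`card_le_of_subinvariant`). In
`eventually_exists_subinvariant` such an `f` is found among the functions of the weight supported
on the ball of radius `ρ n`, with `lam / n` as close to
`(q - 2) ρ + 2 √((q - 1) ρ (1 - ρ))` as desired. With `ρ = lpRadius q δ'` this expression equals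
`(q - 1) - q δ'` (`lpRadius_pos_and_eq`), which exceeds `(q - 1) - q δ` when `δ' < δ`. The ball has
at most `exp (n H_q(ρ))` elements (`card_hammingBall_le`), and `δ' → δ` gives the bound. For
`δ ≥ 1 - 1 / q` the indicator function of `{0}` serves as `f`, and for `δ = 0` the trivial bound
`|C| ≤ q ^ n` suffices.
-/

open Finset

/-! ### Nonnegative spectra on the group of words -/

/-- The character of `(ZMod q)^n` with frequency `κ`. -/
noncomputable def wordChar {q n : ℕ} [NeZero q] (κ z : Fin n → ZMod q) : ℂ :=
  ZMod.stdAddChar (κ ⬝ᵥ z)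

/-- `a` is the family of Fourier coefficients of `p`; only real coefficients are allowed. -/
def HasSpectrum {q n : ℕ} [NeZero q] (p : (Fin n → ZMod q) → ℂ) (a : (Fin n → ZMod q) → ℝ) :
    Prop :=
  ∀ z, p z = ∑ κ, (a κ : ℂ) * wordChar κ z

section Spectrum

variable {q n : ℕ} [NeZero q]

lemma wordChar_add_left (κ ν z : Fin n → ZMod q) :
    wordChar (κ + ν) z = wordChar κ z * wordChar ν z := by
  simp [wordChar, add_dotProduct, AddChar.map_add_eq_mul]

lemma wordChar_neg_left (κ z : Fin n → ZMod q) :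
    wordChar (-κ) z = (starRingEnd ℂ) (wordChar κ z) := by
  simp [wordChar, AddChar.map_neg_eq_conj]

lemma wordChar_sub_right (κ x y : Fin n → ZMod q) :
    wordChar κ (x - y) = wordChar κ x * (starRingEnd ℂ) (wordChar κ y) := by
  rw [wordChar, sub_eq_add_neg, dotProduct_add, dotProduct_neg, AddChar.map_add_eq_mul,
    AddChar.map_neg_eq_conj]
  rfl

lemma wordChar_zero_left (z : Fin n → ZMod q) : wordChar 0 z = 1 := by
  simp [wordChar]

lemma HasSpectrum.mul {p p' : (Fin n → ZMod q) → ℂ} {a a' : (Fin n → ZMod q) → ℝ}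
    (h : HasSpectrum p a) (h' : HasSpectrum p' a') :
    HasSpectrum (fun z => p z * p' z) (fun κ => ∑ ν, a ν * a' (κ - ν)) := by
  intro z
  have e : ∑ κ, ((∑ ν, a ν * a' (κ - ν) : ℝ) : ℂ) * wordChar κ z =
      ∑ ν, ∑ κ, (a ν : ℂ) * (a' (κ - ν) : ℂ) * wordChar κ z := by
    rw [Finset.sum_comm]
    push_cast
    simp only [Finset.sum_mul]
  rw [e]
  simp only [h z, h' z, Finset.sum_mul_sum]
  refine Finset.sum_congr rfl fun ν _ => ?_
  rw [← (Equiv.subRight ν).sum_comp]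
  refine Finset.sum_congr rfl fun κ _ => ?_
  have : wordChar κ z = wordChar ν z * wordChar (κ - ν) z := by
    rw [← wordChar_add_left, add_sub_cancel]
  simp only [Equiv.subRight_apply, this]
  ring

lemma HasSpectrum.conj {p : (Fin n → ZMod q) → ℂ} {a : (Fin n → ZMod q) → ℝ}
    (h : HasSpectrum p a) :
    HasSpectrum (fun z => (starRingEnd ℂ) (p z)) (fun κ => a (-κ)) := by
  intro z
  simp only [h z, map_sum, map_mul, Complex.conj_ofReal, ← wordChar_neg_left]
  rw [← Equiv.sum_comp (Equiv.neg (Fin n → ZMod q))]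
  simp only [Equiv.neg_apply, neg_neg]

/-- A function with nonnegative spectrum is positive definite, and its mean value is a lower
bound for the associated quadratic form on indicator functions. -/
lemma HasSpectrum.le_sum_sum {p : (Fin n → ZMod q) → ℝ} {a : (Fin n → ZMod q) → ℝ}
    (h : HasSpectrum (fun z => (p z : ℂ)) a) (ha : ∀ κ, 0 ≤ a κ) (C : Finset (Fin n → ZMod q)) :
    a 0 * (C.card : ℝ) ^ 2 ≤ ∑ x ∈ C, ∑ y ∈ C, p (x - y) := by
  have key : ((∑ x ∈ C, ∑ y ∈ C, p (x - y) : ℝ) : ℂ)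
      = ((∑ κ, a κ * Complex.normSq (∑ x ∈ C, wordChar κ x) : ℝ) : ℂ) := by
    have h' : ∀ z, (p z : ℂ) = ∑ κ, (a κ : ℂ) * wordChar κ z := h
    push_cast
    simp only [h', ← Complex.mul_conj, map_sum, Finset.sum_mul_sum, wordChar_sub_right]
    simp only [Finset.mul_sum]
    rw [Finset.sum_comm (s := univ)]
    exact Finset.sum_congr rfl fun x _ => Finset.sum_comm
  rw [Complex.ofReal_inj.mp key]
  refine le_trans (le_of_eq ?_) (Finset.single_le_sum
    (f := fun κ => a κ * Complex.normSq (∑ x ∈ C, wordChar κ x))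
    (fun κ _ => mul_nonneg (ha κ) (Complex.normSq_nonneg _)) (Finset.mem_univ 0))
  simp [wordChar_zero_left, Complex.normSq_natCast, sq]

/-- Delsarte's bound: a function with nonnegative spectrum that is nonpositive on the nonzero
differences of a code bounds the size of the code. -/
lemma HasSpectrum.card_le {p : (Fin n → ZMod q) → ℝ} {a : (Fin n → ZMod q) → ℝ}
    (h : HasSpectrum (fun z => (p z : ℂ)) a) (ha : ∀ κ, 0 ≤ a κ) (C : Finset (Fin n → ZMod q))
    (hC : ∀ x ∈ C, ∀ y ∈ C, x ≠ y → p (x - y) ≤ 0) (hp : 0 ≤ p 0) :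
    a 0 * (C.card : ℝ) ≤ p 0 := by
  rcases C.eq_empty_or_nonempty with rfl | hne
  · simpa using hp
  have hpos : (0 : ℝ) < C.card := by exact_mod_cast hne.card_pos
  have h2 : ∑ x ∈ C, ∑ y ∈ C, p (x - y) ≤ ∑ x ∈ C, p 0 := by
    refine Finset.sum_le_sum fun x hx => ?_
    rw [← Finset.add_sum_erase _ _ hx, sub_self]
    have : ∑ y ∈ C.erase x, p (x - y) ≤ 0 := Finset.sum_nonpos fun y hy =>
      hC x hx y (Finset.mem_of_mem_erase hy) (Finset.ne_of_mem_erase hy).symm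
    linarith
  have h1 := (h.le_sum_sum ha C).trans h2
  rw [Finset.sum_const, nsmul_eq_mul] at h1
  nlinarith

end Spectrum

/-! ### The optimal kernel of an odd cycle -/

/-- The value at `±1` of the normalised optimal circulant matrix for `θ_L(C_q)`. -/
noncomputable def cycleCoeff (q : ℕ) : ℝ := 1 / (2 * Real.cos (Real.pi / q))

/-- The normalised optimal circulant matrix for `θ_L(C_q)`, as a function of the difference of
the row and column indices: `1` at `0` and `cycleCoeff q` at `±1`. -/
noncomputable def cycleKernel (q : ℕ) (z : ZMod q) : ℝ :=
  (if z = 0 then 1 else 0) +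
    cycleCoeff q * ((if z + 1 = 0 then 1 else 0) + (if z - 1 = 0 then 1 else 0))

/-- The Fourier coefficients of `cycleKernel`. -/
noncomputable def cycleSpectrum (q : ℕ) [NeZero q] (k : ZMod q) : ℝ :=
  (1 + 2 * cycleCoeff q * (ZMod.stdAddChar k).re) / q

section Cycle

variable {q : ℕ}

lemma cos_pi_div_pos (hq : 3 ≤ q) : 0 < Real.cos (Real.pi / q) := by
  have hq' : (3 : ℝ) ≤ q := by exact_mod_cast hq
  refine Real.cos_pos_of_mem_Ioo ⟨?_, ?_⟩
  · have := Real.pi_pos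
    have : 0 < Real.pi / q := by positivity
    linarith
  · exact div_lt_div_of_pos_left Real.pi_pos (by norm_num) (by linarith)

lemma cycleCoeff_pos (hq : 3 ≤ q) : 0 < cycleCoeff q := by
  have := cos_pi_div_pos hq
  unfold cycleCoeff
  positivity

lemma cycleKernel_nonneg (hq : 3 ≤ q) (z : ZMod q) : 0 ≤ cycleKernel q z := by
  have := (cycleCoeff_pos hq).le
  unfold cycleKernel
  have h1 : (0 : ℝ) ≤ if z = 0 then 1 else 0 := by split_ifs <;> norm_num
  have h2 : (0 : ℝ) ≤ if z + 1 = 0 then 1 else 0 := by split_ifs <;> norm_num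
  have h3 : (0 : ℝ) ≤ if z - 1 = 0 then 1 else 0 := by split_ifs <;> norm_num
  positivity

lemma cycleKernel_zero (hq : 3 ≤ q) : cycleKernel q 0 = 1 := by
  have : Fact (1 < q) := ⟨by omega⟩
  simp [cycleKernel]

lemma cycleKernel_eq_zero {z : ZMod q} (h0 : z ≠ 0) (h1 : z ≠ 1) (h2 : z ≠ -1) :
    cycleKernel q z = 0 := by
  have h2' : z + 1 ≠ 0 := fun h => h2 (eq_neg_of_add_eq_zero_left h)
  simp [cycleKernel, h0, sub_eq_zero, h1, h2']

lemma stdAddChar_re [NeZero q] (j : ℤ) :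
    (ZMod.stdAddChar (j : ZMod q)).re = Real.cos (2 * Real.pi * j / q) := by
  rw [ZMod.stdAddChar_coe]
  have : (2 * (Real.pi : ℂ) * Complex.I * j / q) =
      ((2 * Real.pi * j / q : ℝ) : ℂ) * Complex.I := by push_cast; ring
  rw [this, Complex.exp_ofReal_mul_I_re]

/-- For odd `q` no `q`-th root of unity is closer to `-1` than the two neighbours
`exp (± π i (q - 1) / q)`. -/
lemma neg_cos_le_stdAddChar_re [NeZero q] (hodd : Odd q) (k : ZMod q) :
    -Real.cos (Real.pi / q) ≤ (ZMod.stdAddChar k).re := by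
  have hq0 : (0 : ℝ) < q := by exact_mod_cast NeZero.pos q
  obtain ⟨m, hm⟩ := hodd
  have hk : (((k.val : ℕ) : ℤ) : ZMod q) = k := by simp
  have hlt : k.val < q := ZMod.val_lt k
  rw [← hk, stdAddChar_re, ← Real.cos_pi_sub, ← Real.cos_abs (2 * Real.pi * _ / q)]
  have e : Real.cos |2 * Real.pi * ((k.val : ℤ) : ℝ) / q|
      = - Real.cos (|(q : ℝ) - 2 * k.val| * (Real.pi / q)) := by
    rw [Real.cos_abs, ← Real.cos_abs (|(q : ℝ) - 2 * k.val| * (Real.pi / q)), abs_mul, abs_abs,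
      ← abs_mul, Real.cos_abs, ← Real.cos_pi_sub]
    congr 1
    field_simp
    push_cast
    ring
  rw [e, Real.cos_pi_sub, neg_le_neg_iff]
  have hpq : 0 < Real.pi / q := by have := Real.pi_pos; positivity
  have h1 : (1 : ℝ) ≤ |(q : ℝ) - 2 * k.val| := by
    have : (1 : ℤ) ≤ |(q : ℤ) - 2 * k.val| := by
      apply Int.one_le_abs; omega
    exact_mod_cast this
  have h2 : |(q : ℝ) - 2 * k.val| ≤ q := by
    have : |(q : ℤ) - 2 * k.val| ≤ q := by rw [abs_le]; omega
    exact_mod_cast this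
  refine Real.cos_le_cos_of_nonneg_of_le_pi hpq.le ?_ ?_
  · calc _ ≤ q * (Real.pi / q) := by gcongr
      _ = Real.pi := by field_simp
  · nlinarith

lemma cycleSpectrum_nonneg [NeZero q] (hq : 3 ≤ q) (hodd : Odd q) (k : ZMod q) :
    0 ≤ cycleSpectrum q k := by
  have h1 := neg_cos_le_stdAddChar_re hodd k
  have h2 := cycleCoeff_pos hq
  have h3 : 2 * cycleCoeff q * Real.cos (Real.pi / q) = 1 := by
    have := (cos_pi_div_pos hq).ne'
    unfold cycleCoeff; field_simp
  unfold cycleSpectrum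
  refine div_nonneg ?_ (Nat.cast_nonneg _)
  nlinarith

lemma cycleSpectrum_zero [NeZero q] : cycleSpectrum q 0 = (1 + 2 * cycleCoeff q) / q := by
  simp [cycleSpectrum]

lemma sum_stdAddChar_mul [NeZero q] (z : ZMod q) :
    ∑ k : ZMod q, (ZMod.stdAddChar (k * z) : ℂ) = if z = 0 then (q : ℂ) else 0 := by
  rw [AddChar.sum_mulShift z (ZMod.isPrimitive_stdAddChar q), ZMod.card]
  push_cast
  rfl

lemma cycleKernel_eq_sum [NeZero q] (z : ZMod q) :
    (cycleKernel q z : ℂ) = ∑ k, (cycleSpectrum q k : ℂ) * ZMod.stdAddChar (k * z) := by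
  have hq0 : (q : ℂ) ≠ 0 := by exact_mod_cast NeZero.ne q
  have h : ∀ k : ZMod q, (cycleSpectrum q k : ℂ) * ZMod.stdAddChar (k * z) =
      (1 / q : ℂ) * (ZMod.stdAddChar (k * z) + cycleCoeff q *
        (ZMod.stdAddChar (k * (z + 1)) + ZMod.stdAddChar (k * (z - 1)))) := by
    intro k
    have hre : (2 : ℂ) * ((ZMod.stdAddChar k).re : ℂ) =
        ZMod.stdAddChar k + ZMod.stdAddChar (-k) := by
      rw [AddChar.map_neg_eq_conj, Complex.add_conj]; push_cast; ring
    have e1 : k * (z + 1) = k * z + k := by ring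
    have e2 : k * (z - 1) = k * z + -k := by ring
    rw [e1, e2, AddChar.map_add_eq_mul, AddChar.map_add_eq_mul, cycleSpectrum]
    push_cast
    linear_combination (1 / q : ℂ) * cycleCoeff q * ZMod.stdAddChar (k * z) * hre
  simp only [h, ← Finset.mul_sum, Finset.sum_add_distrib, sum_stdAddChar_mul, cycleKernel]
  split_ifs <;> push_cast <;> field_simp <;> ring

lemma hasSpectrum_prod_cycleKernel [NeZero q] (n : ℕ) :
    HasSpectrum (fun z : Fin n → ZMod q => ((∏ j, cycleKernel q (z j) : ℝ) : ℂ))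
      (fun κ => ∏ j, cycleSpectrum q (κ j)) := by
  intro z
  push_cast
  simp only [cycleKernel_eq_sum, Finset.prod_univ_sum, Fintype.piFinset_univ]
  refine Finset.sum_congr rfl fun κ _ => ?_
  rw [Finset.prod_mul_distrib, wordChar, dotProduct]
  congr 1
  exact (map_prod (ZMod.stdAddChar (N := q)).toMonoidHom
    (fun j => Multiplicative.ofAdd (κ j * z j)) univ).symm

/-- Delsarte's bound for the product of `h` with the tensor power of `cycleKernel`. The kernel
relaxes the sign condition on `h` to the differences with all letters in `{0, 1, -1}`, at the cost
of a factor `q / (1 + 2 * cycleCoeff q)` per letter. -/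
lemma card_le_of_hasSpectrum [NeZero q] (hq : 3 ≤ q) (hodd : Odd q) {n : ℕ}
    {h : (Fin n → ZMod q) → ℝ} {b : (Fin n → ZMod q) → ℝ} {η : ℝ}
    (hb : HasSpectrum (fun z => (h z : ℂ)) b) (hb0 : ∀ κ, 0 ≤ b κ) (hη : 0 < η) (hbη : η ≤ b 0)
    (h0 : 0 ≤ h 0) (C : Finset (Fin n → ZMod q))
    (hC : ∀ x ∈ C, ∀ y ∈ C, x ≠ y →
      (∃ j, x j - y j ≠ 0 ∧ x j - y j ≠ 1 ∧ x j - y j ≠ -1) ∨ h (x - y) ≤ 0) :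
    (C.card : ℝ) ≤ h 0 / η * (q / (1 + 2 * cycleCoeff q)) ^ n := by
  have hq0 : (0 : ℝ) < q := by exact_mod_cast NeZero.pos q
  have hs := cycleSpectrum_nonneg hq hodd
  have hc := cycleCoeff_pos hq
  have hsp : HasSpectrum
      (fun z : Fin n → ZMod q => (((∏ j, cycleKernel q (z j)) * h z : ℝ) : ℂ))
      (fun κ => ∑ ν, (∏ j, cycleSpectrum q (ν j)) * b (κ - ν)) := by
    simpa using (hasSpectrum_prod_cycleKernel n).mul hb
  have hnn : ∀ κ : Fin n → ZMod q, 0 ≤ ∏ j, cycleSpectrum q (κ j) := fun κ =>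
    Finset.prod_nonneg fun j _ => hs _
  have key := hsp.card_le
    (fun κ => Finset.sum_nonneg fun ν _ => mul_nonneg (hnn ν) (hb0 _)) C ?_ ?_
  · have hlow : ((1 + 2 * cycleCoeff q) / q) ^ n * η ≤
        ∑ ν : Fin n → ZMod q, (∏ j, cycleSpectrum q (ν j)) * b (0 - ν) := by
      refine le_trans ?_ (Finset.single_le_sum
        (f := fun ν : Fin n → ZMod q => (∏ j, cycleSpectrum q (ν j)) * b (0 - ν))
        (fun ν _ => mul_nonneg (hnn ν) (hb0 _)) (Finset.mem_univ 0))
      simp only [Pi.zero_apply, cycleSpectrum_zero, Finset.prod_const, Finset.card_univ,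
        Fintype.card_fin, sub_self]
      gcongr
    have h2 := (mul_le_mul_of_nonneg_right hlow (Nat.cast_nonneg C.card)).trans key
    simp only [Pi.zero_apply, cycleKernel_zero hq, Finset.prod_const_one, one_mul] at h2
    have hpos : 0 < ((1 + 2 * cycleCoeff q) / q) ^ n := by positivity
    have e : (q / (1 + 2 * cycleCoeff q)) ^ n = (((1 + 2 * cycleCoeff q) / q) ^ n)⁻¹ := by
      rw [← inv_pow, inv_div]
    rw [e, ← div_eq_mul_inv, div_div, le_div_iff₀ (by positivity)]
    linarith
  · intro x hx y hy hxy
    have hk : 0 ≤ ∏ j, cycleKernel q ((x - y) j) :=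
      Finset.prod_nonneg fun j _ => cycleKernel_nonneg hq _
    rcases hC x hx y hy hxy with ⟨j, h1, h2, h3⟩ | hle
    · rw [Finset.prod_eq_zero (Finset.mem_univ j) (cycleKernel_eq_zero h1 h2 h3), zero_mul]
    · exact mul_nonpos_of_nonneg_of_nonpos hk hle
  · simpa [cycleKernel_zero hq] using h0

end Cycle

/-! ### A lower bound for the theta function of an odd cycle -/

section Theta

open CycleCode

lemma exists_isLovaszFeasible {V : Type*} [Fintype V] (G : SimpleGraph V) :
    ∃ D : Matrix V V ℝ, IsLovaszFeasible G D := by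
  classical
  refine ⟨(Fintype.card V : ℝ) • (1 : Matrix V V ℝ), ?_, ?_⟩
  · rw [Matrix.posSemidef_iff_dotProduct_mulVec]
    refine ⟨?_, fun x => ?_⟩
    · ext i j
      simp [Matrix.one_apply, eq_comm]
    · have h := sq_sum_le_card_mul_sum_sq (s := (univ : Finset V)) (f := x)
      have e : (Matrix.of fun _ _ => (1 : ℝ)).mulVec x = fun _ : V => ∑ i, x i := by
        ext i; simp [Matrix.mulVec, dotProduct]
      rw [Matrix.sub_mulVec, Matrix.smul_mulVec, Matrix.one_mulVec, e]
      simp only [star_trivial, dotProduct_sub, dotProduct_smul, smul_eq_mul]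
      simp only [dotProduct, ← Finset.sum_mul]
      rw [Finset.card_univ] at h
      simp only [← sq]
      linarith
  · intro v w h
    simp [h.ne]

lemma CycleCode.IsLovaszFeasible.sq_sum_le {V : Type*} [Fintype V] {G : SimpleGraph V} {D : Matrix V V ℝ}
    (hD : IsLovaszFeasible G D) (x : V → ℝ) :
    (∑ v, x v) ^ 2 ≤ ∑ v, ∑ w, D v w * (x v * x w) := by
  have h := hD.1.dotProduct_mulVec_nonneg x
  have e : (Matrix.of fun _ _ => (1 : ℝ)).mulVec x = fun _ : V => ∑ i, x i := by
    ext i; simp [Matrix.mulVec, dotProduct]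
  rw [Matrix.sub_mulVec, e] at h
  simp only [star_trivial, dotProduct_sub] at h
  simp only [dotProduct, Matrix.mulVec, Finset.mul_sum] at h
  rw [sq, Finset.sum_mul_sum]
  refine (sub_nonneg.mp h).trans (le_of_eq ?_)
  exact Finset.sum_congr rfl fun v _ => Finset.sum_congr rfl fun w _ => by ring

/-- `Fin q` and `ZMod q` agree only after unfolding, so the identification is packaged as an
equivalence under which the cycle is the Cayley graph of `{1, -1}`. -/
lemma exists_equiv_cycleGraph_adj_iff {q : ℕ} (hq : 3 ≤ q) :
    ∃ e : Fin q ≃ ZMod q, ∀ v w, (SimpleGraph.cycleGraph q).Adj v w ↔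
      e v - e w = 1 ∨ e v - e w = -1 := by
  obtain ⟨m, rfl⟩ : ∃ m, q = m + 2 := ⟨q - 2, by omega⟩
  refine ⟨Equiv.refl (Fin (m + 2)), fun v w => ?_⟩
  have h : ∀ a b : ZMod (m + 2), b - a = 1 ↔ a - b = -1 := fun a b => by
    rw [← neg_sub, neg_eq_iff_eq_neg]
  exact SimpleGraph.cycleGraph_adj.trans (or_congr_right (h v w))

/-- Testing `D ⪰ J` against the all-ones vector and against the real and imaginary parts of the
character of frequency `(q - 1) / 2`, which takes the value `-cos (π / q)` on every edge. -/
lemma le_lovaszTheta_cycleGraph {q : ℕ} [NeZero q] (hq3 : 3 ≤ q) (hodd : Odd q) :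
    (q : ℝ) / (1 + 2 * cycleCoeff q) ≤ lovaszTheta (SimpleGraph.cycleGraph q) := by
  obtain ⟨m, hq⟩ := hodd
  obtain ⟨e, he⟩ := exists_equiv_cycleGraph_adj_iff hq3
  have hq0 : (0 : ℝ) < q := by positivity
  have hcos := cos_pi_div_pos hq3
  have hc := cycleCoeff_pos hq3
  unfold lovaszTheta
  obtain ⟨D₀, hD₀⟩ := exists_isLovaszFeasible (SimpleGraph.cycleGraph q)
  refine le_csInf ⟨_, D₀, hD₀, rfl⟩ ?_
  rintro t ⟨D, hD, rfl⟩
  set t := Finset.univ.sup' Finset.univ_nonempty fun v => D v v with ht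
  have htr : ∑ v, D v v ≤ q * t := by
    calc ∑ v, D v v ≤ ∑ _v : Fin q, t :=
          Finset.sum_le_sum fun v _ => Finset.le_sup' (fun v => D v v) (Finset.mem_univ v)
      _ = q * t := by simp
  let χ : Fin q → ℂ := fun v => ZMod.stdAddChar ((m : ZMod q) * e v)
  have hone : (ZMod.stdAddChar (m : ZMod q)).re = -Real.cos (Real.pi / q) := by
    have := stdAddChar_re (q := q) (m : ℤ)
    rw [Int.cast_natCast] at this
    rw [this, ← Real.cos_pi_sub]
    congr 1
    have : (q : ℝ) = 2 * m + 1 := by exact_mod_cast hq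
    push_cast
    field_simp
    linarith
  have hχ : ∀ v w : Fin q, (χ v).re * (χ w).re + (χ v).im * (χ w).im =
      (ZMod.stdAddChar ((m : ZMod q) * (e v - e w))).re := by
    intro v w
    have : (ZMod.stdAddChar ((m : ZMod q) * (e v - e w)) : ℂ) = χ v * (starRingEnd ℂ) (χ w) := by
      simp only [χ]
      rw [mul_sub, sub_eq_add_neg, AddChar.map_add_eq_mul, AddChar.map_neg_eq_conj]
    rw [this]
    simp
  have h1 := hD.sq_sum_le (fun _ => 1)
  have h2 := (sq_nonneg _).trans (hD.sq_sum_le fun v : Fin q => (χ v).re)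
  have h3 := (sq_nonneg _).trans (hD.sq_sum_le fun v : Fin q => (χ v).im)
  have h4 : ∑ v, ∑ w, D v w * (((χ v).re * (χ w).re + (χ v).im * (χ w).im) +
      Real.cos (Real.pi / q) * (1 * 1)) = (1 + Real.cos (Real.pi / q)) * ∑ v, D v v := by
    rw [Finset.mul_sum]
    refine Finset.sum_congr rfl fun v _ => ?_
    rw [Finset.sum_eq_single v]
    · rw [hχ, sub_self]
      simp
      ring
    · intro w _ hw
      by_cases hA : (SimpleGraph.cycleGraph q).Adj v w
      · have : (ZMod.stdAddChar ((m : ZMod q) * (e v - e w))).re =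
            -Real.cos (Real.pi / q) := by
          rcases (he v w).mp hA with h | h
          · rw [h, mul_one, hone]
          · rw [h, mul_neg, mul_one, AddChar.map_neg_eq_conj, Complex.conj_re, hone]
        rw [hχ, this]
        ring
      · rw [hD.2 v w ⟨fun h => hw h.symm, hA⟩, zero_mul]
    · simp
  have h5 : ∑ v, ∑ w, D v w * (((χ v).re * (χ w).re + (χ v).im * (χ w).im) +
      Real.cos (Real.pi / q) * (1 * 1)) =
      ∑ v, ∑ w, D v w * ((χ v).re * (χ w).re) + ∑ v, ∑ w, D v w * ((χ v).im * (χ w).im) +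
        Real.cos (Real.pi / q) * ∑ v, ∑ w, D v w * (1 * 1) := by
    simp only [Finset.mul_sum, ← Finset.sum_add_distrib]
    exact Finset.sum_congr rfl fun v _ => Finset.sum_congr rfl fun w _ => by ring
  have h6 : Real.cos (Real.pi / q) * (q : ℝ) ^ 2 ≤
      (1 + Real.cos (Real.pi / q)) * ∑ v, D v v := by
    rw [← h4, h5]
    have : (∑ _v : Fin q, (1 : ℝ)) = q := by simp
    rw [this] at h1
    have := mul_le_mul_of_nonneg_left h1 hcos.le
    linarith
  have h7 : Real.cos (Real.pi / q) * (q : ℝ) ^ 2 ≤ (1 + Real.cos (Real.pi / q)) * (q * t) :=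
    h6.trans (mul_le_mul_of_nonneg_left htr (by positivity))
  have h8 : Real.cos (Real.pi / q) * q ≤ (1 + Real.cos (Real.pi / q)) * t := by
    refine le_of_mul_le_mul_right ?_ hq0
    linarith
  rw [div_le_iff₀ (by positivity)]
  have h9 : cycleCoeff q * Real.cos (Real.pi / q) = 1 / 2 := by
    unfold cycleCoeff; field_simp
  refine le_of_mul_le_mul_right ?_ hcos
  linear_combination h8 - 2 * t * h9

end Theta

/-! ### The Hamming graph acting on the spectrum -/

section Hamming

variable {q n : ℕ}

/-- The eigenvalue `n (q - 1) - q |z|` of the Hamming graph `H(n, q)` at the character of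
frequency `z`. -/
noncomputable def hammingEigenvalue {q n : ℕ} (z : Fin n → ZMod q) : ℝ :=
  n * ((q : ℝ) - 1) - q * hammingNorm z

/-- The adjacency operator of the Hamming graph: on each coordinate line through `κ` the values
are summed and the value at `κ` itself is subtracted. -/
def hammingAdj {q n : ℕ} [NeZero q] (a : (Fin n → ZMod q) → ℝ) (κ : Fin n → ZMod q) : ℝ :=
  ∑ j, ((∑ v, a (κ - Pi.single j v)) - a κ)

lemma hammingNorm_eq_erase_add (κ : Fin n → ZMod q) (j : Fin n) :
    hammingNorm κ = #{i ∈ univ.erase j | κ i ≠ 0} + if κ j ≠ 0 then 1 else 0 := by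
  rw [hammingNorm, Finset.card_filter, Finset.card_filter,
    ← Finset.add_sum_erase _ _ (Finset.mem_univ j), add_comm]

lemma exists_hammingNorm_eq (hq : 2 ≤ q) {i : ℕ} (hi : i ≤ n) :
    ∃ κ : Fin n → ZMod q, hammingNorm κ = i := by
  have : Fact (1 < q) := ⟨hq⟩
  refine ⟨fun j => if (j : ℕ) < i then 1 else 0, ?_⟩
  simp [hammingNorm, Fin.card_filter_val_lt, hi]

variable [NeZero q]

lemma hammingEigenvalue_eq_sum (z : Fin n → ZMod q) :
    (hammingEigenvalue z : ℂ) =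
      ∑ j, ((∑ v : ZMod q, wordChar (Pi.single j v) z) - 1) := by
  have h : ∀ j, ∑ v : ZMod q, wordChar (Pi.single j v) z =
      (q : ℂ) - if z j ≠ 0 then (q : ℂ) else 0 := by
    intro j
    simp only [wordChar, single_dotProduct, sum_stdAddChar_mul]
    split_ifs <;> simp_all
  simp only [h, hammingEigenvalue, hammingNorm, Finset.sum_sub_distrib, ← Finset.sum_filter,
    Finset.sum_const, Finset.card_univ, Fintype.card_fin, nsmul_eq_mul]
  push_cast
  ring

lemma HasSpectrum.hammingAdj {p : (Fin n → ZMod q) → ℂ} {a : (Fin n → ZMod q) → ℝ}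
    (h : HasSpectrum p a) :
    HasSpectrum (fun z => (hammingEigenvalue z : ℂ) * p z) (hammingAdj a) := by
  intro z
  have key : ∀ j : Fin n, ∑ κ, ((∑ v, a (κ - Pi.single j v) : ℝ) : ℂ) * wordChar κ z =
      (∑ v : ZMod q, wordChar (Pi.single j v) z) * p z := by
    intro j
    push_cast
    simp only [Finset.sum_mul]
    rw [Finset.sum_comm]
    refine Finset.sum_congr rfl fun v _ => ?_
    rw [h z, Finset.mul_sum, ← Equiv.sum_comp (Equiv.addRight (Pi.single j v))]
    refine Finset.sum_congr rfl fun κ _ => ?_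
    rw [Equiv.coe_addRight, add_sub_cancel_right, wordChar_add_left]
    ring
  simp only [_root_.hammingAdj]
  push_cast
  simp only [Finset.sum_mul, sub_mul]
  rw [Finset.sum_comm, hammingEigenvalue_eq_sum, Finset.sum_mul]
  refine Finset.sum_congr rfl fun j _ => ?_
  rw [Finset.sum_sub_distrib, sub_mul, one_mul, ← key j, ← h z]
  push_cast
  simp only [Finset.sum_mul]

lemma sum_hammingNorm_sub_single (u : ℕ → ℝ) (κ : Fin n → ZMod q) (j : Fin n) :
    ∑ v, u (hammingNorm (κ - Pi.single j v)) =
      u #{i ∈ univ.erase j | κ i ≠ 0} + (q - 1) * u (#{i ∈ univ.erase j | κ i ≠ 0} + 1) := by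
  have h : ∀ v, hammingNorm (κ - Pi.single j v) =
      #{i ∈ univ.erase j | κ i ≠ 0} + if κ j ≠ v then 1 else 0 := by
    intro v
    rw [hammingNorm_eq_erase_add _ j]
    congr 1
    · congr 1
      refine Finset.filter_congr fun i hi => ?_
      simp [Pi.single_eq_of_ne (Finset.ne_of_mem_erase hi)]
    · simp [sub_eq_zero]
  rw [← Finset.add_sum_erase _ _ (Finset.mem_univ (κ j)), h]
  have h' : ∀ v ∈ univ.erase (κ j), u (hammingNorm (κ - Pi.single j v)) =
      u (#{i ∈ univ.erase j | κ i ≠ 0} + 1) := fun v hv => by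
    rw [h, if_pos (Finset.ne_of_mem_erase hv).symm]
  rw [Finset.sum_congr rfl h', Finset.sum_const, nsmul_eq_mul, Finset.card_erase_of_mem
    (Finset.mem_univ _), Finset.card_univ, ZMod.card, Nat.cast_sub NeZero.one_le]
  simp

/-- The adjacency operator of the Hamming graph on functions of the weight. -/
lemma hammingAdj_comp_hammingNorm (u : ℕ → ℝ) (κ : Fin n → ZMod q) :
    hammingAdj (fun ν => u (hammingNorm ν)) κ =
      hammingNorm κ * (u (hammingNorm κ - 1) + (q - 2) * u (hammingNorm κ)) +
        (n - hammingNorm κ) * ((q - 1) * u (hammingNorm κ + 1)) := by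
  have h : ∀ j, (∑ v, u (hammingNorm (κ - Pi.single j v))) - u (hammingNorm κ) =
      if κ j ≠ 0 then u (hammingNorm κ - 1) + (q - 2) * u (hammingNorm κ)
      else (q - 1) * u (hammingNorm κ + 1) := by
    intro j
    rw [sum_hammingNorm_sub_single]
    have e := hammingNorm_eq_erase_add κ j
    split_ifs with hj
    · rw [if_pos hj] at e
      rw [e, Nat.add_sub_cancel]
      ring
    · rw [if_neg hj, add_zero] at e
      rw [← e]
      ring
  have hcard : (#{j | ¬ κ j ≠ 0} : ℝ) = n - hammingNorm κ := by
    have := Finset.card_filter_add_card_filter_not (s := (univ : Finset (Fin n)))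
      (fun j => κ j ≠ 0)
    rw [Finset.card_univ, Fintype.card_fin] at this
    rw [eq_sub_iff_add_eq, add_comm]
    exact_mod_cast this
  simp only [hammingAdj, h]
  rw [Finset.sum_ite, Finset.sum_const, Finset.sum_const, nsmul_eq_mul, nsmul_eq_mul, hcard]
  rfl

/-- A subinvariant weight function on the spectrum bounds codes: if `u` is nonnegative and
`A u ≥ lam u` for the adjacency operator `A` of the Hamming graph, then
`(hammingEigenvalue z - t) * |F z| ^ 2`, with `F` the function with spectrum `u`, is feasible in
Delsarte's bound, and Cauchy-Schwarz on the support of `u` estimates its value at `0`. -/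
lemma card_le_of_subinvariant (hq : 3 ≤ q) (hodd : Odd q) {u : ℕ → ℝ} {t lam B : ℝ}
    (hu : ∀ i, 0 ≤ u i) (htl : t < lam) (ht : t ≤ n * ((q : ℝ) - 1))
    (hlam : ∀ i : ℕ, i ≤ n → lam * u i ≤
      i * (u (i - 1) + (q - 2) * u i) + (n - i) * ((q - 1) * u (i + 1)))
    (hne : ∃ i ≤ n, u i ≠ 0)
    (hB : (#{κ : Fin n → ZMod q | u (hammingNorm κ) ≠ 0} : ℝ) ≤ B)
    (C : Finset (Fin n → ZMod q))
    (hC : ∀ x ∈ C, ∀ y ∈ C, x ≠ y →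
      (∃ j, x j - y j ≠ 0 ∧ x j - y j ≠ 1 ∧ x j - y j ≠ -1) ∨ hammingEigenvalue (x - y) ≤ t) :
    (C.card : ℝ) ≤
      (n * ((q : ℝ) - 1) - t) / (lam - t) * B * (q / (1 + 2 * cycleCoeff q)) ^ n := by
  have hc := cycleCoeff_pos hq
  set f : (Fin n → ZMod q) → ℝ := fun κ => u (hammingNorm κ) with hf
  have hf0 : ∀ κ, 0 ≤ f κ := fun κ => hu _
  set F : (Fin n → ZMod q) → ℂ := fun z => ∑ κ, (f κ : ℂ) * wordChar κ z with hF
  have hFs : HasSpectrum F f := fun z => rfl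
  set b : (Fin n → ZMod q) → ℝ := fun κ => hammingAdj f κ - t * f κ with hb
  have hbf : ∀ κ, (lam - t) * f κ ≤ b κ := by
    intro κ
    have hle : hammingNorm κ ≤ n := by
      simpa using hammingNorm_le_card_fintype (x := κ)
    have := hlam _ hle
    rw [← hammingAdj_comp_hammingNorm] at this
    simp only [hb, hf] at this ⊢
    linarith
  have hb0 : ∀ κ, 0 ≤ b κ := fun κ =>
    (mul_nonneg (sub_pos.mpr htl).le (hf0 κ)).trans (hbf κ)
  have hbs : HasSpectrum (fun z => ((hammingEigenvalue z - t : ℝ) : ℂ) * F z) b := by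
    intro z
    have := hFs.hammingAdj z
    simp only [hb, Complex.ofReal_sub, Complex.ofReal_mul, sub_mul, Finset.sum_sub_distrib, this,
      mul_assoc, ← Finset.mul_sum]
    rw [← hFs z]
  have hsp : HasSpectrum
      (fun z => (((hammingEigenvalue z - t) * Complex.normSq (F z) : ℝ) : ℂ))
      (fun κ => ∑ ν, b ν * f (-(κ - ν))) := by
    intro z
    rw [← (hbs.mul hFs.conj) z]
    push_cast
    rw [← Complex.mul_conj]
    ring
  have hS : 0 < ∑ κ, f κ ^ 2 := by
    obtain ⟨i, hi, hui⟩ := hne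
    obtain ⟨κ, hκ⟩ := exists_hammingNorm_eq (q := q) (by omega) hi
    refine Finset.sum_pos' (fun κ _ => sq_nonneg _) ⟨κ, Finset.mem_univ _, ?_⟩
    have : f κ ≠ 0 := by simpa [hf, hκ] using hui
    positivity
  have hη : (lam - t) * ∑ κ, f κ ^ 2 ≤ ∑ ν, b ν * f (-(0 - ν)) := by
    rw [Finset.mul_sum]
    refine Finset.sum_le_sum fun ν _ => ?_
    rw [zero_sub, neg_neg]
    nlinarith [hbf ν, hf0 ν]
  have hF0 : F 0 = ((∑ κ, f κ : ℝ) : ℂ) := by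
    simp [hF, wordChar]
  have hE0 : hammingEigenvalue (0 : Fin n → ZMod q) = n * ((q : ℝ) - 1) := by
    simp [hammingEigenvalue]
  have hCS : (∑ κ, f κ) ^ 2 ≤ B * ∑ κ, f κ ^ 2 := by
    have h1 : ∑ κ, f κ = ∑ κ with f κ ≠ 0, f κ := (Finset.sum_filter_ne_zero _).symm
    rw [h1]
    refine sq_sum_le_card_mul_sum_sq.trans ?_
    refine mul_le_mul hB ?_ (Finset.sum_nonneg fun _ _ => sq_nonneg _)
      ((Nat.cast_nonneg _).trans hB)
    exact Finset.sum_le_sum_of_subset_of_nonneg (Finset.filter_subset _ _)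
      fun _ _ _ => sq_nonneg _
  have key := card_le_of_hasSpectrum hq hodd hsp
    (fun κ => Finset.sum_nonneg fun ν _ => mul_nonneg (hb0 _) (hf0 _))
    (mul_pos (sub_pos.mpr htl) hS) hη ?_ C ?_
  · refine key.trans ?_
    rw [hE0, hF0, Complex.normSq_ofReal, ← sq]
    gcongr
    rw [div_mul_eq_mul_div, div_le_div_iff₀ (mul_pos (sub_pos.mpr htl) hS) (sub_pos.mpr htl)]
    have := mul_le_mul_of_nonneg_left hCS
      (mul_nonneg (sub_nonneg.mpr ht) (sub_pos.mpr htl).le)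
    linarith
  · rw [hE0]
    exact mul_nonneg (sub_nonneg.mpr ht) (Complex.normSq_nonneg _)
  · intro x hx y hy hxy
    refine (hC x hx y hy hxy).imp_right fun h => ?_
    exact mul_nonpos_of_nonpos_of_nonneg (sub_nonpos.mpr h) (Complex.normSq_nonneg _)

end Hamming

open Filter Topology

/-! ### Volume of Hamming balls -/

section Ball

variable {q : ℕ} [NeZero q]

lemma sum_pow_hammingNorm (n : ℕ) (T : ℝ) :
    ∑ κ : Fin n → ZMod q, T ^ hammingNorm κ = (1 + (q - 1) * T) ^ n := by
  have h : ∀ κ : Fin n → ZMod q, T ^ hammingNorm κ = ∏ j, if κ j ≠ 0 then T else 1 := by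
    intro κ
    rw [← Finset.prod_filter, Finset.prod_const]
    rfl
  have h1 : ∑ k : ZMod q, (if k ≠ 0 then T else 1) = 1 + (q - 1) * T := by
    rw [← Finset.add_sum_erase _ _ (Finset.mem_univ (0 : ZMod q))]
    rw [Finset.sum_congr rfl (g := fun _ => T) fun k hk => if_pos (Finset.ne_of_mem_erase hk)]
    rw [Finset.sum_const, nsmul_eq_mul, Finset.card_erase_of_mem (Finset.mem_univ _),
      Finset.card_univ, ZMod.card, Nat.cast_sub NeZero.one_le]
    simp
  calc ∑ κ : Fin n → ZMod q, T ^ hammingNorm κ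
      = ∏ _j : Fin n, ∑ k : ZMod q, (if k ≠ 0 then T else 1) := by
        rw [Finset.prod_univ_sum, Fintype.piFinset_univ]
        exact Finset.sum_congr rfl fun κ _ => h κ
    _ = _ := by rw [h1]; simp

/-- Chernoff's bound for the volume of a Hamming ball: each word of weight at most `ρ n` is
counted with weight `T ^ (|κ| - ρ n) ≥ 1`, for the optimal `T = ρ / ((1 - ρ) (q - 1))`. -/
lemma card_hammingBall_le (hq : 2 ≤ q) {ρ : ℝ} (h0 : 0 < ρ) (h1 : q * ρ ≤ q - 1) (n : ℕ) :
    (#{κ : Fin n → ZMod q | (hammingNorm κ : ℝ) ≤ ρ * n} : ℝ) ≤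
      Real.exp (n * Real.qaryEntropy q ρ) := by
  have hq' : (2 : ℝ) ≤ q := by exact_mod_cast hq
  have hρ : 0 < 1 - ρ := by nlinarith
  have hq1 : (0 : ℝ) < q - 1 := by linarith
  set T := ρ / ((1 - ρ) * (q - 1)) with hT
  have hT0 : 0 < T := by positivity
  have hT1 : T ≤ 1 := by
    rw [hT, div_le_one (by positivity)]; nlinarith
  have hlog : Real.log T ≤ 0 := Real.log_nonpos hT0.le hT1
  have hent : Real.qaryEntropy q ρ = -(ρ * Real.log T) - Real.log (1 - ρ) := by
    rw [hT, Real.log_div h0.ne' (by positivity), Real.log_mul hρ.ne' hq1.ne', Real.qaryEntropy,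
      Real.binEntropy, Real.log_inv, Real.log_inv]
    push_cast
    ring
  have hone : 1 + (q - 1) * T = (1 - ρ)⁻¹ := by
    rw [hT]; field_simp; ring
  calc (#{κ : Fin n → ZMod q | (hammingNorm κ : ℝ) ≤ ρ * n} : ℝ)
      = ∑ κ : Fin n → ZMod q with (hammingNorm κ : ℝ) ≤ ρ * n, (1 : ℝ) := by simp
    _ ≤ ∑ κ : Fin n → ZMod q with (hammingNorm κ : ℝ) ≤ ρ * n,
          Real.exp (-(ρ * n) * Real.log T) * T ^ hammingNorm κ := by
        refine Finset.sum_le_sum fun κ hκ => ?_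
        rw [Finset.mem_filter] at hκ
        have e : T ^ hammingNorm κ = Real.exp (hammingNorm κ * Real.log T) := by
          rw [Real.exp_nat_mul, Real.exp_log hT0]
        rw [e, ← Real.exp_add, Real.one_le_exp_iff]
        nlinarith [hκ.2]
    _ ≤ ∑ κ : Fin n → ZMod q, Real.exp (-(ρ * n) * Real.log T) * T ^ hammingNorm κ :=
        Finset.sum_le_sum_of_subset_of_nonneg (Finset.filter_subset _ _)
          fun _ _ _ => by positivity
    _ = Real.exp (n * Real.qaryEntropy q ρ) := by
        rw [← Finset.mul_sum, sum_pow_hammingNorm, hone, hent, inv_pow, ← Real.exp_log hρ,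
          ← Real.exp_nat_mul, ← Real.exp_neg, ← Real.exp_add, Real.exp_log hρ]
        congr 1
        ring

end Ball

/-! ### Subinvariant functions supported on a window of weights -/

/-- On the weights between `ρ₁ n` and `ρ₂ n` the adjacency operator of the Hamming graph
dominates `n` times a tridiagonal matrix with constant coefficients, which after the rescaling by
`s ^ i` has the discrete sine as its Perron eigenvector. -/
lemma eventually_exists_subinvariant {q : ℕ} (hq : 2 ≤ q) {ρ₁ ρ₂ Λ : ℝ} (h1 : 0 < ρ₁)
    (h12 : ρ₁ < ρ₂) (h2 : ρ₂ < 1)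
    (hΛ : Λ < 2 * √((q - 1) * ρ₁ * (1 - ρ₂)) + (q - 2) * ρ₁) :
    ∀ᶠ n : ℕ in atTop, ∃ u : ℕ → ℝ, (∀ i, 0 ≤ u i) ∧ (∀ i, u i ≠ 0 → (i : ℝ) ≤ ρ₂ * n) ∧
      (∃ i ≤ n, u i ≠ 0) ∧ ∀ i : ℕ, i ≤ n → Λ * n * u i ≤
        i * (u (i - 1) + (q - 2) * u i) + (n - i) * ((q - 1) * u (i + 1)) := by
  have hq' : (2 : ℝ) ≤ q := by exact_mod_cast hq
  have hρ : 0 < 1 - ρ₂ := by linarith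
  have hq1 : (0 : ℝ) < q - 1 := by linarith
  set M := √((q - 1) * ρ₁ * (1 - ρ₂)) with hM
  have hM0 : 0 < M := Real.sqrt_pos.mpr (by positivity)
  have hMsq : M * M = (q - 1) * ρ₁ * (1 - ρ₂) := Real.mul_self_sqrt (by positivity)
  set s := ρ₁ / M with hs
  have hs0 : 0 < s := by positivity
  have hsM : s * M = ρ₁ := by rw [hs]; field_simp
  have hsM' : (1 - ρ₂) * (q - 1) * s = M := by
    refine mul_right_cancel₀ hM0.ne' ?_
    rw [hMsq, mul_assoc, hsM]; ring
  have hlen : Tendsto (fun n : ℕ => ((⌊ρ₂ * n⌋₊ : ℝ) - ⌈ρ₁ * n⌉₊ + 2)) atTop atTop := by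
    refine tendsto_atTop_mono (f := fun n : ℕ => (ρ₂ - ρ₁) * n) (fun n => ?_)
      (tendsto_natCast_atTop_atTop.const_mul_atTop (sub_pos.mpr h12))
    have e1 := Nat.lt_floor_add_one (ρ₂ * n)
    have e2 := Nat.ceil_lt_add_one (a := ρ₁ * n) (by positivity)
    linarith
  have hcos : Tendsto (fun n : ℕ =>
      2 * M * Real.cos (Real.pi / ((⌊ρ₂ * n⌋₊ : ℝ) - ⌈ρ₁ * n⌉₊ + 2)) + (q - 2) * ρ₁) atTop
      (𝓝 (2 * M * Real.cos 0 + (q - 2) * ρ₁)) :=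
    (((Real.continuous_cos.tendsto 0).comp (hlen.const_div_atTop Real.pi)).const_mul _).add_const _
  rw [Real.cos_zero, mul_one] at hcos
  filter_upwards [hcos.eventually_const_lt hΛ, hlen.eventually_ge_atTop 2, eventually_ge_atTop 1]
    with n hn hlen2 hn1
  have hn0 : (0 : ℝ) < n := by exact_mod_cast hn1
  set r := ⌊ρ₂ * n⌋₊ with hr
  set a := ⌈ρ₁ * n⌉₊ with ha
  set φ := Real.pi / ((r : ℝ) - a + 2) with hφ
  have hφ0 : 0 < φ := div_pos Real.pi_pos (by linarith)
  have hφπ : φ * ((r : ℝ) - a + 2) = Real.pi := div_mul_cancel₀ _ (by linarith)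
  have har : a ≤ r := by
    have : (a : ℝ) ≤ r := by linarith
    exact_mod_cast this
  have ha1 : 1 ≤ a := Nat.one_le_ceil_iff.mpr (by positivity)
  have har' : ∀ i : ℕ, a ≤ i → ρ₁ * n ≤ i := fun i hi =>
    (Nat.le_ceil _).trans (by exact_mod_cast hi)
  have hir' : ∀ i : ℕ, i ≤ r → (i : ℝ) ≤ ρ₂ * n := fun i hi =>
    le_trans (by exact_mod_cast hi) (Nat.floor_le (by nlinarith))
  set u : ℕ → ℝ := fun i =>
    if a ≤ i ∧ i ≤ r then s ^ i * Real.sin (((i : ℝ) - a + 1) * φ) else 0 with hu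
  have hsin : ∀ i : ℕ, a ≤ i → i ≤ r → 0 < Real.sin (((i : ℝ) - a + 1) * φ) := by
    intro i h1 h2
    have h1' : (a : ℝ) ≤ i := by exact_mod_cast h1
    have h2' : (i : ℝ) ≤ r := by exact_mod_cast h2
    refine Real.sin_pos_of_pos_of_lt_pi (mul_pos (by linarith) hφ0) ?_
    rw [← hφπ, mul_comm]
    exact mul_lt_mul_of_pos_left (by linarith) hφ0
  have hu0 : ∀ i, 0 ≤ u i := by
    intro i
    simp only [hu]
    split_ifs with h
    · exact mul_nonneg (by positivity) (hsin i h.1 h.2).le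
    · exact le_rfl
  have hrn : r ≤ n := by
    have : (r : ℝ) ≤ n := (hir' r le_rfl).trans (by nlinarith)
    exact_mod_cast this
  refine ⟨u, hu0, ?_, ⟨a, har.trans hrn, ?_⟩, ?_⟩
  · intro i hi
    by_cases h : a ≤ i ∧ i ≤ r
    · exact hir' i h.2
    · exact absurd (if_neg h) hi
  · simp only [hu, if_pos (And.intro le_rfl har)]
    exact (mul_pos (by positivity) (hsin a le_rfl har)).ne'
  · intro i hin
    have hin' : (0 : ℝ) ≤ n - i := by
      have : (i : ℝ) ≤ n := by exact_mod_cast hin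
      linarith
    by_cases h : a ≤ i ∧ i ≤ r
    · obtain ⟨k, rfl⟩ : ∃ k, i = k + 1 := ⟨i - 1, by omega⟩
      have e2 : u (k + 1) = s ^ k * s * Real.sin (((k : ℝ) - a + 2) * φ) := by
        simp only [hu, if_pos h]
        rw [pow_succ]; push_cast; ring_nf
      have e1 : u k = s ^ k * Real.sin (((k : ℝ) - a + 1) * φ) := by
        by_cases hk : a ≤ k
        · simp only [hu, if_pos (And.intro hk (show k ≤ r by omega))]
        · have : (k : ℝ) + 1 = a := by
            have : k + 1 = a := by omega
            exact_mod_cast this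
          simp only [hu, hk, false_and, if_false]
          rw [show (k : ℝ) - a + 1 = 0 by linarith]
          simp
      have e3 : u (k + 2) = s ^ k * s * s * Real.sin (((k : ℝ) - a + 3) * φ) := by
        by_cases hk : k + 2 ≤ r
        · simp only [hu, if_pos (And.intro (show a ≤ k + 2 by omega) hk)]
          rw [pow_succ, pow_succ]; push_cast; ring_nf
        · have : (k : ℝ) + 1 = r := by
            have : k + 1 = r := by omega
            exact_mod_cast this
          simp only [hu, hk, and_false, if_false]
          rw [show (k : ℝ) - a + 3 = r - a + 2 by linarith, mul_comm _ φ, hφπ]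
          simp
      have etri : Real.sin (((k : ℝ) - a + 1) * φ) + Real.sin (((k : ℝ) - a + 3) * φ) =
          2 * Real.cos φ * Real.sin (((k : ℝ) - a + 2) * φ) := by
        rw [show ((k : ℝ) - a + 1) * φ = ((k : ℝ) - a + 2) * φ - φ by ring,
          show ((k : ℝ) - a + 3) * φ = ((k : ℝ) - a + 2) * φ + φ by ring,
          Real.sin_sub, Real.sin_add]
        ring
      have b1 : ρ₁ * n * (u k + (q - 2) * u (k + 1)) ≤
          ((k + 1 : ℕ) : ℝ) * (u k + (q - 2) * u (k + 1)) :=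
        mul_le_mul_of_nonneg_right (har' _ h.1)
          (add_nonneg (hu0 _) (mul_nonneg (by linarith) (hu0 _)))
      have b2 : (1 - ρ₂) * n * ((q - 1) * u (k + 2)) ≤
          ((n : ℝ) - (k + 1 : ℕ)) * ((q - 1) * u (k + 2)) :=
        mul_le_mul_of_nonneg_right (by have := hir' _ h.2; linarith)
          (mul_nonneg hq1.le (hu0 _))
      have emain : ρ₁ * n * (u k + (q - 2) * u (k + 1)) + (1 - ρ₂) * n * ((q - 1) * u (k + 2)) =
          (2 * M * Real.cos φ + (q - 2) * ρ₁) * n * u (k + 1) := by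
        have c1 : ρ₁ * u k + (1 - ρ₂) * (q - 1) * u (k + 2) = 2 * M * Real.cos φ * u (k + 1) := by
          rw [e1, e2, e3]
          linear_combination s ^ k * s * M * etri -
            s ^ k * Real.sin (((k : ℝ) - a + 1) * φ) * hsM +
            s ^ k * s * Real.sin (((k : ℝ) - a + 3) * φ) * hsM'
        linear_combination (n : ℝ) * c1
      have b3 : Λ * n * u (k + 1) ≤ (2 * M * Real.cos φ + (q - 2) * ρ₁) * n * u (k + 1) :=
        mul_le_mul_of_nonneg_right (mul_le_mul_of_nonneg_right hn.le hn0.le) (hu0 _)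
      rw [Nat.add_sub_cancel]
      linarith
    · have : u i = 0 := if_neg h
      rw [this]
      have b1 := mul_nonneg (Nat.cast_nonneg (α := ℝ) i) (hu0 (i - 1))
      have b2 := mul_nonneg hin' (mul_nonneg hq1.le (hu0 (i + 1)))
      linarith

/-! ### The radius in the linear programming bound -/

/-- The argument of the entropy function in `CycleCode.rateLP1`. -/
noncomputable def lpRadius (q : ℕ) (δ : ℝ) : ℝ :=
  (((q : ℝ) - 1) - ((q : ℝ) - 2) * δ - 2 * √(((q : ℝ) - 1) * δ * (1 - δ))) / (q : ℝ)

section Radius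

variable {q : ℕ} {δ : ℝ}

lemma continuous_lpRadius (q : ℕ) : Continuous (lpRadius q) := by
  unfold lpRadius
  fun_prop

lemma mul_lpRadius_le (hq : 2 ≤ q) (h0 : 0 ≤ δ) : q * lpRadius q δ ≤ q - 1 := by
  have hq' : (2 : ℝ) ≤ q := by exact_mod_cast hq
  have hq0 : (q : ℝ) ≠ 0 := by positivity
  rw [lpRadius, mul_div_cancel₀ _ hq0]
  have := Real.sqrt_nonneg (((q : ℝ) - 1) * δ * (1 - δ))
  nlinarith

/-- `lpRadius q δ` is a positive number at which the asymptotic spectral radius of a Hamming ball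
equals the normalised Hamming eigenvalue `(q - 1) - q δ`. Both claims follow from
`q ρ = (√((q - 1) (1 - δ)) - √δ) ^ 2` and `q (1 - ρ) = (√((q - 1) δ) + √(1 - δ)) ^ 2`. -/
lemma lpRadius_pos_and_eq (hq : 2 ≤ q) (h0 : 0 ≤ δ) (h1 : δ < 1 - 1 / q) :
    0 < lpRadius q δ ∧ 2 * √((q - 1) * lpRadius q δ * (1 - lpRadius q δ)) +
      (q - 2) * lpRadius q δ = (q - 1) - q * δ := by
  have hq' : (2 : ℝ) ≤ q := by exact_mod_cast hq
  have hq0 : (0 : ℝ) < q := by positivity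
  have hqδ : q * δ < q - 1 := by
    have := mul_lt_mul_of_pos_left h1 hq0
    rwa [mul_sub, mul_one, mul_one_div_cancel hq0.ne'] at this
  have hδ1 : 0 < 1 - δ := by nlinarith
  have hs : √((q : ℝ) - 1) ^ 2 = q - 1 := Real.sq_sqrt (by linarith)
  have ha : √(1 - δ) ^ 2 = 1 - δ := Real.sq_sqrt hδ1.le
  have hb : √δ ^ 2 = δ := Real.sq_sqrt h0
  have hs0 := Real.sqrt_nonneg ((q : ℝ) - 1)
  have ha0 := Real.sqrt_nonneg (1 - δ)
  have hb0 := Real.sqrt_nonneg δ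
  have hprod : √(((q : ℝ) - 1) * δ * (1 - δ)) = √((q : ℝ) - 1) * √δ * √(1 - δ) := by
    rw [Real.sqrt_mul (mul_nonneg (by linarith) h0), Real.sqrt_mul (by linarith)]
  set s := √((q : ℝ) - 1)
  set a := √(1 - δ)
  set b := √δ
  have hsab : 0 < s * a - b := by
    refine sub_pos.mpr (lt_of_pow_lt_pow_left₀ 2 (by positivity) ?_)
    rw [mul_pow, hs, ha, hb]
    linarith
  have e1 : lpRadius q δ = (s * a - b) ^ 2 / q := by
    rw [lpRadius, hprod]
    congr 1
    linear_combination (-a ^ 2) * hs - ((q : ℝ) - 1) * ha - hb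
  have e2 : 1 - lpRadius q δ = (s * b + a) ^ 2 / q := by
    rw [lpRadius, hprod, eq_div_iff hq0.ne', sub_mul, div_mul_cancel₀ _ hq0.ne']
    linear_combination (-b ^ 2) * hs - ((q : ℝ) - 1) * hb - ha
  have e3 : √((q - 1) * lpRadius q δ * (1 - lpRadius q δ)) =
      s * (s * a - b) * (s * b + a) / q := by
    rw [e2, e1, ← Real.sqrt_sq (show 0 ≤ s * (s * a - b) * (s * b + a) / q by positivity), ← hs]
    congr 1
    field_simp
  refine ⟨by rw [e1]; positivity, ?_⟩
  have key : 2 * (s * (s * a - b) * (s * b + a)) + (s ^ 2 + 1 - 2) * (s * a - b) ^ 2 =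
      (s ^ 2 + 1) * (s ^ 2 - (s ^ 2 + 1) * b ^ 2) := by
    linear_combination (1 + s ^ 2) * s ^ 2 * (ha + hb)
  rw [hs, hb] at key
  rw [e3, e1]
  field_simp
  linear_combination key

end Radius

/-! ### Asymptotic rates -/

section Rate

open CycleCode

lemma wordDist_eq_hammingNorm {V : Type*} (G : SimpleGraph V) {q n : ℕ} (e : V ≃ ZMod q)
    {x y : Fin n → V} (h : ∀ j, x j = y j ∨ G.Adj (x j) (y j)) :
    wordDist G x y = ((hammingNorm (e ∘ x - e ∘ y) : ℝ) : EReal) := by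
  have h1 : ∀ j, vertexDist G (x j) (y j) =
      (((if (e ∘ x - e ∘ y) j ≠ 0 then 1 else 0 : ℝ)) : EReal) := by
    intro j
    by_cases hj : x j = y j
    · simp [vertexDist, hj]
    · simp [vertexDist, hj, (h j).resolve_left hj, sub_eq_zero]
  rw [wordDist, Finset.sum_congr rfl fun j _ => h1 j, hammingNorm, Finset.card_filter]
  push_cast
  exact (map_sum (⟨⟨Real.toEReal, EReal.coe_zero⟩, EReal.coe_add⟩ : ℝ →+ EReal) _ _).symm

/-- A maximum independent set of `C_q(n, d)`, as a code over `ZMod q`. -/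
lemma exists_code_card_eq_indepNum {q : ℕ} (hq : 3 ≤ q) (n : ℕ) (d : ℝ) :
    ∃ C : Finset (Fin n → ZMod q),
      C.card = (wordGraph (SimpleGraph.cycleGraph q) n d).indepNum ∧
      ∀ x ∈ C, ∀ y ∈ C, x ≠ y →
        (∃ j, x j - y j ≠ 0 ∧ x j - y j ≠ 1 ∧ x j - y j ≠ -1) ∨
          d < (hammingNorm (x - y) : ℝ) := by
  obtain ⟨e, he⟩ := exists_equiv_cycleGraph_adj_iff hq
  obtain ⟨S, hS⟩ := SimpleGraph.exists_isNIndepSet_indepNum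
    (G := wordGraph (SimpleGraph.cycleGraph q) n d)
  refine ⟨S.map (Equiv.arrowCongr (Equiv.refl _) e).toEmbedding, ?_, ?_⟩
  · rw [Finset.card_map, hS.card_eq]
  · simp only [Finset.mem_map_equiv]
    intro x hx y hy hxy
    set x' := (Equiv.arrowCongr (Equiv.refl (Fin n)) e).symm x with hx'
    set y' := (Equiv.arrowCongr (Equiv.refl (Fin n)) e).symm y with hy'
    have hxe : x = e ∘ x' := by ext j; simp [hx']
    have hye : y = e ∘ y' := by ext j; simp [hy']
    have hne : x' ≠ y' := fun h => hxy (by rw [hxe, hye, h])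
    by_contra! hcon
    refine hS.isIndepSet hx hy hne ⟨hne, ?_⟩
    rw [wordDist_eq_hammingNorm _ e, ← hxe, ← hye]
    · exact_mod_cast hcon.2
    · intro j
      by_cases h0 : x j - y j = 0
      · left
        rw [hxe, hye] at h0
        exact e.injective (sub_eq_zero.mp h0)
      · right
        rw [he]
        by_cases h1 : x j - y j = 1
        · left; rw [hxe, hye] at h1; exact h1
        · right
          have := hcon.1 j h0 h1
          rw [hxe, hye] at this; exact this

lemma rate_le_of_eventually_le {V : Type*} [Fintype V] [Nonempty V] {G : SimpleGraph V}
    {δ A B : ℝ} (hA : 0 < A)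
    (h : ∀ᶠ n : ℕ in atTop, ((wordGraph G n (δ * n)).indepNum : ℝ) ≤
      A * (n + 1) * Real.exp (n * B)) :
    rate G δ ≤ B := by
  have hlim : Tendsto (fun n : ℕ => (1 / (n : ℝ)) * (Real.log A + Real.log (n + 1)) + B) atTop
      (𝓝 B) := by
    have h1 : Tendsto (fun n : ℕ => (1 / (n : ℝ)) * Real.log A) atTop (𝓝 0) := by
      simpa using tendsto_one_div_atTop_nhds_zero_nat.mul_const (Real.log A)
    have h2 : Tendsto (fun n : ℕ => (1 / (n : ℝ)) * Real.log (n + 1)) atTop (𝓝 0) := by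
      have h3 : Tendsto (fun n : ℕ => Real.log ((n : ℝ) + 1) / ((n : ℝ) + 1)) atTop (𝓝 0) := by
        have := Real.isLittleO_log_id_atTop.tendsto_div_nhds_zero.comp
          (tendsto_atTop_add_const_right _ (1 : ℝ) tendsto_natCast_atTop_atTop)
        exact this
      have h4 : Tendsto (fun n : ℕ => 1 + 1 / (n : ℝ)) atTop (𝓝 1) := by
        simpa using tendsto_one_div_atTop_nhds_zero_nat.const_add (1 : ℝ)
      have h5 := h3.mul h4
      rw [zero_mul] at h5
      refine h5.congr' ?_
      filter_upwards [eventually_ge_atTop 1] with n hn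
      have : (n : ℝ) ≠ 0 := by positivity
      field_simp
    simpa [mul_add] using (h1.add h2).add_const B
  have hle : ∀ᶠ n : ℕ in atTop,
      (1 / (n : ℝ)) * Real.log ((wordGraph G n (δ * n)).indepNum : ℝ) ≤
        (1 / (n : ℝ)) * (Real.log A + Real.log (n + 1)) + B := by
    filter_upwards [h, eventually_ge_atTop 1] with n hn hn1
    have hn0 : (0 : ℝ) < n := by exact_mod_cast hn1
    have hpos : (0 : ℝ) < (wordGraph G n (δ * n)).indepNum := by
      have : ({fun _ => Classical.arbitrary V} : Finset (Fin n → V)).card ≤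
          (wordGraph G n (δ * n)).indepNum :=
        SimpleGraph.IsIndepSet.card_le_indepNum (by simp [SimpleGraph.IsIndepSet])
      rw [Finset.card_singleton] at this
      exact_mod_cast this
    have := Real.log_le_log hpos hn
    rw [Real.log_mul (by positivity) (Real.exp_pos _).ne', Real.log_exp,
      Real.log_mul hA.ne' (by positivity)] at this
    calc _ ≤ (1 / (n : ℝ)) * (Real.log A + Real.log (n + 1) + n * B) := by gcongr
      _ = _ := by field_simp
  refine (limsup_le_limsup hle ?_ hlim.isBoundedUnder_le).trans hlim.limsup_eq.le
  refine IsBoundedUnder.isCoboundedUnder_le ⟨0, ?_⟩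
  rw [eventually_map]
  exact Eventually.of_forall fun n => mul_nonneg (by positivity) (Real.log_natCast_nonneg _)

/-- The logarithm of the explicit value of `θ_L(C_q)`. -/
noncomputable def logCycleTheta (q : ℕ) : ℝ := Real.log (q / (1 + 2 * cycleCoeff q))

lemma logCycleTheta_nonneg {q : ℕ} (hq : 3 ≤ q) : 0 ≤ logCycleTheta q := by
  have hc := cycleCoeff_pos hq
  have hq' : (3 : ℝ) ≤ q := by exact_mod_cast hq
  have hpi := Real.pi_pos
  have hcos : 1 / 2 ≤ Real.cos (Real.pi / q) := by
    rw [← Real.cos_pi_div_three]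
    refine Real.cos_le_cos_of_nonneg_of_le_pi (by positivity) (by linarith) ?_
    gcongr
  have hc1 : cycleCoeff q ≤ 1 := by
    rw [cycleCoeff, div_le_one (by linarith)]
    linarith
  refine Real.log_nonneg ?_
  rw [le_div_iff₀ (by positivity)]
  linarith

lemma qaryEntropy_lpRadius_zero {q : ℕ} (hq : 3 ≤ q) :
    Real.qaryEntropy q (lpRadius q 0) = Real.log q := by
  have hq' : (3 : ℝ) ≤ q := by exact_mod_cast hq
  have hq0 : (q : ℝ) ≠ 0 := by linarith
  have hq1 : (q : ℝ) - 1 ≠ 0 := by linarith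
  have e1 : lpRadius q 0 = ((q : ℝ) - 1) / q := by simp [lpRadius]
  have e2 : 1 - ((q : ℝ) - 1) / q = 1 / q := by field_simp; ring
  rw [e1, Real.qaryEntropy, Real.binEntropy, e2, inv_div, Real.log_div hq0 hq1, inv_div, div_one]
  push_cast
  field_simp
  ring

variable {q : ℕ} [NeZero q]

lemma exp_mul_logCycleTheta (hq : 3 ≤ q) (n : ℕ) :
    Real.exp (n * logCycleTheta q) = (q / (1 + 2 * cycleCoeff q)) ^ n := by
  have := cycleCoeff_pos hq
  have hq0 : (0 : ℝ) < q := by exact_mod_cast NeZero.pos q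
  rw [Real.exp_nat_mul, logCycleTheta, Real.exp_log (by positivity)]

lemma logCycleTheta_le (hq : 3 ≤ q) (hodd : Odd q) :
    logCycleTheta q ≤ Real.log (lovaszTheta (SimpleGraph.cycleGraph q)) := by
  have := cycleCoeff_pos hq
  have hq0 : (0 : ℝ) < q := by exact_mod_cast NeZero.pos q
  exact Real.log_le_log (by positivity) (le_lovaszTheta_cycleGraph hq hodd)

/-- Plotkin's range: the subinvariant function is the indicator of the zero frequency. -/
lemma rate_cycleGraph_le_of_ge (hq : 3 ≤ q) (hodd : Odd q) {δ : ℝ}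
    (hδ : 1 - 1 / (q : ℝ) ≤ δ) :
    rate (SimpleGraph.cycleGraph q) δ ≤ logCycleTheta q := by
  have hq' : (3 : ℝ) ≤ q := by exact_mod_cast hq
  refine rate_le_of_eventually_le (A := q) (by linarith) (Eventually.of_forall fun n => ?_)
  obtain ⟨C, hC, hcode⟩ := exists_code_card_eq_indepNum hq n (δ * n)
  rw [← hC, exp_mul_logCycleTheta hq]
  have hn0 : (0 : ℝ) ≤ n := Nat.cast_nonneg n
  have hbound := card_le_of_subinvariant (n := n) hq hodd
    (u := fun i => if i = 0 then 1 else 0) (t := -1) (lam := 0) (B := 1)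
    (fun i => by split_ifs <;> norm_num) (by norm_num)
    (by have : 0 ≤ (n : ℝ) * (q - 1) := mul_nonneg hn0 (by linarith)
        linarith)
    (fun i hi => ?_) ⟨0, Nat.zero_le n, by simp⟩ ?_ C ?_
  · have hc := cycleCoeff_pos hq
    refine hbound.trans (mul_le_mul_of_nonneg_right ?_ (by positivity))
    linarith
  · have h1 : (0 : ℝ) ≤ if i - 1 = 0 then 1 else 0 := by split_ifs <;> norm_num
    have h2 : (0 : ℝ) ≤ if i = 0 then 1 else 0 := by split_ifs <;> norm_num
    have h3 : (q - 2 : ℝ) ≥ 0 := by linarith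
    simp only [Nat.add_one_ne_zero, if_false, zero_mul, mul_zero, add_zero]
    positivity
  · have : #{κ : Fin n → ZMod q | (if hammingNorm κ = 0 then (1 : ℝ) else 0) ≠ 0} = 1 := by
      rw [Finset.card_eq_one]
      exact ⟨0, by ext κ; simp⟩
    exact_mod_cast this.le
  · intro x hx y hy hxy
    refine (hcode x hx y hy hxy).imp_right fun h => ?_
    -- The eigenvalue is a negative integer.
    have h1 : (n : ℝ) * (q - 1) < q * hammingNorm (x - y) := by
      have h2 : (1 - 1 / (q : ℝ)) * n ≤ δ * n := mul_le_mul_of_nonneg_right hδ hn0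
      have h3 := mul_lt_mul_of_pos_left (h2.trans_lt h) (show (0 : ℝ) < q by linarith)
      refine lt_of_eq_of_lt ?_ h3
      field_simp
    have h4 : (n : ℤ) * (q - 1) + 1 ≤ q * hammingNorm (x - y) := by
      have : (n : ℤ) * (q - 1) < q * hammingNorm (x - y) := by exact_mod_cast h1
      omega
    have h5 : (n : ℝ) * (q - 1) + 1 ≤ q * hammingNorm (x - y) := by exact_mod_cast h4
    rw [hammingEigenvalue]
    linarith

/-- The bound at `δ` by the entropy of the radius for a smaller `δ'`: the gap `δ - δ'` makes the
spectral radius of the window exceed `n ((q - 1) - q δ)` by a positive multiple of `n`. -/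
lemma rate_cycleGraph_le_of_lt (hq : 3 ≤ q) (hodd : Odd q) {δ δ' : ℝ} (h0 : 0 ≤ δ')
    (h1 : δ' < δ) (h2 : δ < 1 - 1 / (q : ℝ)) :
    rate (SimpleGraph.cycleGraph q) δ ≤
      logCycleTheta q + Real.qaryEntropy q (lpRadius q δ') := by
  have hq' : (3 : ℝ) ≤ q := by exact_mod_cast hq
  have hq0 : (0 : ℝ) < q := by linarith
  have hq2 : 2 ≤ q := by omega
  obtain ⟨hρ0, hρ⟩ := lpRadius_pos_and_eq hq2 h0 (h1.trans h2)
  have hρq := mul_lpRadius_le hq2 h0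
  set ρ := lpRadius q δ' with hρdef
  have hρ1 : ρ < 1 := by nlinarith
  -- An inner radius `ρ₁ < ρ` at which the spectral radius is still large enough.
  have hgap : (q - 1) - q * δ < 2 * √((q - 1) * ρ * (1 - ρ)) + (q - 2) * ρ := by
    rw [hρ]; nlinarith
  have hcont : Continuous fun ρ₁ : ℝ => 2 * √((q - 1) * ρ₁ * (1 - ρ)) + (q - 2) * ρ₁ := by
    fun_prop
  have hev : ∀ᶠ ρ₁ in 𝓝[<] ρ,
      (q - 1) - q * δ < 2 * √((q - 1) * ρ₁ * (1 - ρ)) + (q - 2) * ρ₁ ∧ ρ₁ ∈ Set.Ioo 0 ρ :=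
    (((hcont.tendsto ρ).mono_left nhdsWithin_le_nhds).eventually_const_lt hgap).and
      (Ioo_mem_nhdsLT hρ0)
  obtain ⟨ρ₁, hρ₁, hρ₁0, hρ₁ρ⟩ := hev.exists
  obtain ⟨Λ, hΛ, hΛ'⟩ := exists_between hρ₁
  have hε : 0 < Λ - ((q - 1) - q * δ) := by linarith
  have hδ : 0 < δ := by linarith
  refine rate_le_of_eventually_le (A := q * δ / (Λ - ((q - 1) - q * δ))) (by positivity) ?_
  filter_upwards [eventually_exists_subinvariant hq2 hρ₁0 hρ₁ρ hρ1 hΛ', eventually_ge_atTop 1]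
    with n ⟨u, hu, husupp, hune, hulam⟩ hn1
  have hn0 : (0 : ℝ) < n := by exact_mod_cast hn1
  obtain ⟨C, hC, hcode⟩ := exists_code_card_eq_indepNum hq n (δ * n)
  have hbound := card_le_of_subinvariant (n := n) hq hodd hu
    (t := ((q - 1) - q * δ) * n) (lam := Λ * n) (B := Real.exp (n * Real.qaryEntropy q ρ))
    (mul_lt_mul_of_pos_right hΛ hn0) (by nlinarith [mul_pos (mul_pos hq0 hδ) hn0])
    hulam hune ?_ C ?_
  · rw [← hC, mul_add (n : ℝ) (logCycleTheta q), Real.exp_add, exp_mul_logCycleTheta hq]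
    have hc := cycleCoeff_pos hq
    have e : (n * ((q : ℝ) - 1) - ((q - 1) - q * δ) * n) / (Λ * n - ((q - 1) - q * δ) * n) =
        q * δ / (Λ - ((q - 1) - q * δ)) := by
      rw [← sub_mul, ← mul_div_mul_right _ (Λ - ((q - 1) - q * δ)) hn0.ne']
      congr 1
      ring
    rw [e] at hbound
    refine hbound.trans ?_
    set K := q * δ / (Λ - ((q - 1) - q * δ)) with hK
    have hK0 : 0 < K := by positivity
    have hP : 0 < Real.exp (n * Real.qaryEntropy q ρ) * (q / (1 + 2 * cycleCoeff q)) ^ n := by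
      positivity
    nlinarith [mul_pos (mul_pos hK0 hn0) hP]
  · refine le_trans ?_ (card_hammingBall_le hq2 hρ0 hρq n)
    exact_mod_cast Finset.card_le_card fun κ hκ => by
      rw [Finset.mem_filter] at hκ ⊢
      exact ⟨hκ.1, husupp _ hκ.2⟩
  · intro x hx y hy hxy
    refine (hcode x hx y hy hxy).imp_right fun h => ?_
    rw [hammingEigenvalue]
    nlinarith

lemma rate_cycleGraph_zero_le (hq : 3 ≤ q) :
    rate (SimpleGraph.cycleGraph q) 0 ≤ Real.log q := by
  have hq0 : (0 : ℝ) < q := by exact_mod_cast NeZero.pos q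
  refine rate_le_of_eventually_le (A := 1) one_pos (Eventually.of_forall fun n => ?_)
  obtain ⟨C, hC, -⟩ := exists_code_card_eq_indepNum hq n (0 * n)
  rw [← hC, Real.exp_nat_mul, Real.exp_log hq0, one_mul]
  have h : (C.card : ℝ) ≤ (q : ℝ) ^ n := by
    have := Finset.card_le_univ C
    rw [Fintype.card_fun, ZMod.card, Fintype.card_fin] at this
    exact_mod_cast this
  have : (0 : ℝ) ≤ n * (q : ℝ) ^ n := by positivity
  linarith

end Rate

theorem mainTheorem3 (q : ℕ) [NeZero q] (hq : 3 ≤ q) (hodd : Odd q) :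
    (∀ δ : ℝ, 0 ≤ δ →
      CycleCode.rate (SimpleGraph.cycleGraph q) δ ≤
        Real.log (CycleCode.lovaszTheta (SimpleGraph.cycleGraph q)) + CycleCode.rateLP1 q δ) ∧
    (∀ δ : ℝ, 1 - 1 / (q : ℝ) ≤ δ →
      CycleCode.rate (SimpleGraph.cycleGraph q) δ ≤
        Real.log (CycleCode.lovaszTheta (SimpleGraph.cycleGraph q))) := by
  have hθ := logCycleTheta_le hq hodd
  have hplotkin : ∀ δ : ℝ, 1 - 1 / (q : ℝ) ≤ δ →
      CycleCode.rate (SimpleGraph.cycleGraph q) δ ≤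
        Real.log (CycleCode.lovaszTheta (SimpleGraph.cycleGraph q)) :=
    fun δ hδ => (rate_cycleGraph_le_of_ge hq hodd hδ).trans hθ
  refine ⟨fun δ hδ => ?_, hplotkin⟩
  by_cases h : δ < 1 - 1 / (q : ℝ)
  · have hLP : CycleCode.rateLP1 q δ = Real.qaryEntropy q (lpRadius q δ) := if_pos h
    rw [hLP]
    rcases hδ.eq_or_lt with rfl | hpos
    · rw [qaryEntropy_lpRadius_zero hq]
      have := rate_cycleGraph_zero_le hq
      have := logCycleTheta_nonneg hq
      linarith
    · have hlim : Tendsto (fun δ' => logCycleTheta q + Real.qaryEntropy q (lpRadius q δ'))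
          (𝓝[<] δ) (𝓝 (logCycleTheta q + Real.qaryEntropy q (lpRadius q δ))) :=
        (((Real.qaryEntropy_continuous.comp (continuous_lpRadius q)).tendsto δ).mono_left
          nhdsWithin_le_nhds).const_add _
      have hle : CycleCode.rate (SimpleGraph.cycleGraph q) δ ≤
          logCycleTheta q + Real.qaryEntropy q (lpRadius q δ) := by
        refine ge_of_tendsto hlim ?_
        filter_upwards [Ioo_mem_nhdsLT hpos] with δ' hδ'
        exact rate_cycleGraph_le_of_lt hq hodd hδ'.1.le hδ'.2 h
      linarith
  · have hLP : CycleCode.rateLP1 q δ = 0 := if_neg h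
    rw [hLP, add_zero]
    exact hplotkin δ (not_lt.mp h)
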